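/- Let $G=(V,E)$ be a finite oriented degree-3 graph: a finite directed graph without loops and 2-cycles in which at every vertex the in-degree plus the out-degree is at most 3. A feedback arc set is a set $F\subseteq E$ such that $(V,E\setminus F)$ has no directed cycle, and $\mathrm{OPT}_{\mathrm{minFAS}}(G)$ is the minimum cardinality of a feedback arc set of $G$. *The complex $\mathcal K(G)$.* The modified dunce hat $\mathcal D$ is the 2-dimensional simplicial complex on the vertices $s,t,a,b,c,x,y$ (with 7 vertices, 19 edges and 13 triangles, 39 simplices in all) whose maximal simplices are the triangles $$say,\ sxy,\ sxb,\ sxt,\ sbt,\ axb,\ axt,\ axc,\ ayb,\ atc,\ xyc,\ ybt,\ ytc.$$ It is a triangulated disk with boundary heptagon $s\,x\,a\,s\,x\,a\,x$, boundary vertices of the same name and the edges between them being identified. Put $\Gamma=say$, $\omega=sa$ (the only edge contained in just one triangle), $\varphi=tb$, $\psi=tc$, $\eta=st$. Take disjoint copies $\mathcal D_e$ of $\mathcal D$, one for each $e\in E$, and make the following identifications of vertices (and so of the edges they span): $s_e\sim s_f$ if $e,f$ have the same tail; $t_e\sim t_f$ if $e,f$ have the same head; and if $e=(u,v)$ and $f=(v,w)$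 are edges, then $\omega_f=s_fa_f$ is identified with $\varphi_e=t_eb_e$ or with $\psi_e=t_ec_e$ (by $s_f\sim t_e$ and $a_f\sim b_e$, respectively $a_f\sim c_e$). Which of the two is used is a fixed choice for each such pair $(e,f)$, arbitrary except that for fixed $e$ different edges $f$ leaving the head of $e$ use different edges of $\mathcal D_e$; such a choice exists because the degrees are at most 3. The resulting simplicial complex is $\mathcal K(G)$; its simplices are the images of the simplices of the copies $\mathcal D_e$. *Erasability.* A simplicial collapse passes from a complex to a subcomplex by removing exactly two simplices $\sigma\subsetneq\tau$. A complex is erasable if finitely many collapses turn it into a complex of dimension at most 1. A free face of $\tau$ is a proper nonempty face of $\tau$ for which $\tau$ is the unique maximal simplex containing it. A maximal simplex without free faces is called internal. For a finite 2-dimensional complex $\mathcal K$ let $\mathrm{er}(\mathcal K)$ be the minimal number of internal 2-simplices whose removal from $\mathcal K$ leaves an erasable complex. **Lemma.** For every such $G$ and every admissible choice in the construction of $\mathcal K(G)$, $$\mathrm{er}(\mathcal K(G))=\mathrm{OPT}_{\mathrm{minFAS}}(G).$$ In particular, sets of internal 2-simplices whose removal makes $\mathcal K(G)$ erasable exist.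 Moreover $\mathrm{OPT}_{\mathrm{minFAS}}(G)$ is also the minimal number of arbitrary 2-simplices of $\mathcal K(G)$ whose removal leaves an erasable complex. -/

import Mathlib

section Erasability

variable {W : Type*}

/-- `σ` is a free face of `τ` in `K`: a proper (nonempty) face of `τ` such that `τ` is the unique
maximal face of `K` containing `σ`. -/
def IsFreeFace (K : PreAbstractSimplicialComplex W) (σ τ : Finset W) : Prop :=
  σ ∈ K ∧ τ ∈ K ∧ σ ⊂ τ ∧ ∀ ρ ∈ K, σ ⊆ ρ → ρ ⊆ τ

/-- A simplicial (elementary) collapse: `L` is a subcomplex of `K` and the faces of `K` that are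
not in `L` are exactly two simplices, one of which is a proper face of the other. -/
def ElementaryCollapse (K L : PreAbstractSimplicialComplex W) : Prop :=
  L ≤ K ∧ ∃ σ τ : Finset W, σ ⊂ τ ∧ K.faces \ L.faces = {σ, τ}

/-- `K` collapses to `L`: `L` is obtained from `K` by finitely many simplicial collapses. -/
def Collapses (K L : PreAbstractSimplicialComplex W) : Prop :=
  Relation.ReflTransGen ElementaryCollapse K L

/-- `K` is erasable: it collapses to a complex of dimension at most one. -/
def IsErasable (K : PreAbstractSimplicialComplex W) : Prop :=
  ∃ L : PreAbstractSimplicialComplex W, Collapses K L ∧ ∀ σ ∈ L, σ.card ≤ 2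

/-- `τ` is an internal 2-face of `K`: a maximal face of dimension two without free faces. -/
def IsInternalTwoFace (K : PreAbstractSimplicialComplex W) (τ : Finset W) : Prop :=
  τ ∈ K ∧ τ.card = 3 ∧ (∀ ρ ∈ K, τ ⊆ ρ → ρ = τ) ∧ ∀ σ, ¬ IsFreeFace K σ τ

/-- The complex left after removing the simplices in `C` (together with all simplices that have
one of them as a face). If all members of `C` are maximal in `K`, the set of faces of the result
is just `K.faces \ C`. -/
def removeFaces (K : PreAbstractSimplicialComplex W) (C : Set (Finset W)) :
    PreAbstractSimplicialComplex W where
  faces := {σ | σ ∈ K.faces ∧ ∀ c ∈ C, ¬ c ⊆ σ}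
  isRelLowerSet_faces := by
    rintro σ ⟨hσ, hC⟩
    refine ⟨(K.isRelLowerSet_faces hσ).1, fun τ hτσ hτ => ⟨?_, fun c hc hcτ => ?_⟩⟩
    · exact (K.isRelLowerSet_faces hσ).2 hτσ hτ
    · exact hC c hc (hcτ.trans hτσ)

/-- The numbers `k` such that removing some `k` internal 2-faces makes `K` erasable. -/
def internalErasureSizes (K : PreAbstractSimplicialComplex W) : Set ℕ :=
  {k | ∃ C : Finset (Finset W), C.card = k ∧ (∀ τ ∈ C, IsInternalTwoFace K τ) ∧
    IsErasable (removeFaces K C)}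

/-- The numbers `k` such that removing some `k` 2-simplices makes `K` erasable. -/
def erasureSizes (K : PreAbstractSimplicialComplex W) : Set ℕ :=
  {k | ∃ C : Finset (Finset W), C.card = k ∧ (∀ τ ∈ C, τ ∈ K ∧ τ.card = 3) ∧
    IsErasable (removeFaces K C)}

/-- `er(K)`: the minimal number of internal 2-faces that need to be removed from `K` to get an
erasable complex. -/
noncomputable def er (K : PreAbstractSimplicialComplex W) : ℕ :=
  sInf (internalErasureSizes K)

end Erasability

section DirectedGraphs

variable {V : Type*}

/-- An oriented graph: a directed graph without 2-cycles and (the case `u = v`) without loops. -/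
def IsOrientedGraph (G : Digraph V) : Prop :=
  ∀ u v, G.Adj u v → ¬ G.Adj v u

/-- A directed degree-3 graph: at every vertex, out-degree plus in-degree is at most 3. -/
def IsDegreeThree (G : Digraph V) : Prop :=
  ∀ v, {w | G.Adj v w}.ncard + {u | G.Adj u v}.ncard ≤ 3

/-- The directed graph has no directed cycle (no closed directed walk of positive length). -/
def IsAcyclicDigraph (G : Digraph V) : Prop :=
  ∀ v, ¬ Relation.TransGen G.Adj v v

/-- The graph `(V, E \ F)`. -/
def deleteArcs (G : Digraph V) (F : Finset (V × V)) : Digraph V where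
  Adj u v := G.Adj u v ∧ (u, v) ∉ F

/-- `F` is a feedback arc set of `G`. -/
def IsFeedbackArcSet (G : Digraph V) (F : Finset (V × V)) : Prop :=
  (∀ p ∈ F, G.Adj p.1 p.2) ∧ IsAcyclicDigraph (deleteArcs G F)

/-- The minimum cardinality of a feedback arc set of `G`. -/
noncomputable def optMinFAS (G : Digraph V) : ℕ :=
  sInf {k | ∃ F : Finset (V × V), IsFeedbackArcSet G F ∧ F.card = k}

end DirectedGraphs

section DunceHat

/-- The seven vertices of the modified dunce hat. -/
inductive DunceVertex : Type
  | s | t | a | b | c | x | y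
  deriving DecidableEq

instance : Fintype DunceVertex where
  elems := {DunceVertex.s, DunceVertex.t, DunceVertex.a, DunceVertex.b, DunceVertex.c,
    DunceVertex.x, DunceVertex.y}
  complete := by intro z; cases z <;> decide

open DunceVertex in
/-- The thirteen triangles of the modified dunce hat `D`. They triangulate a disk with four
interior vertices `t, b, c, y` whose boundary is the heptagon `s x a s x a x` with the boundary
vertices and edges of equal name identified. So the edges `sx` and `xa` occur three times on the
boundary, and `ω = sa` occurs once and is the only free edge. The distinguished simplices are
the triangle `Γ = say`, its free edge `ω = sa`, the edges `φ = tb`, `ψ = tc`, `η = st`, and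
their vertices. -/
def dunceFacets : Finset (Finset DunceVertex) :=
  {{s, a, y}, {s, x, y}, {s, x, b}, {s, x, t}, {s, b, t}, {a, x, b}, {a, x, t}, {a, x, c},
    {a, y, b}, {a, t, c}, {x, y, c}, {y, b, t}, {y, t, c}}

/-- The modified dunce hat `D`, a complex with 7 vertices, 19 edges and 13 triangles. -/
def dunceHat : PreAbstractSimplicialComplex DunceVertex where
  faces := {σ | σ.Nonempty ∧ ∃ τ ∈ dunceFacets, σ ⊆ τ}
  isRelLowerSet_faces := by
    rintro σ ⟨hσ, τ, hτ, hστ⟩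
    exact ⟨hσ, fun ρ hρσ hρ => ⟨hρ, τ, hτ, hρσ.trans hστ⟩⟩

/-- The end other than `t` of the edge `φ = tb` (for `false`) or `ψ = tc` (for `true`). -/
def portVertex : Bool → DunceVertex
  | false => DunceVertex.b
  | true => DunceVertex.c

end DunceHat

section Construction

variable {V : Type*}

/-- The edges of a directed graph; `e.1.1` is the tail and `e.1.2` the head of `e`. -/
def Arc (G : Digraph V) : Type _ := {p : V × V // G.Adj p.1 p.2}

/-- The tail of an edge. -/
def Arc.tail {G : Digraph V} (e : Arc G) : V := e.1.1

/-- The head of an edge. -/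
def Arc.head {G : Digraph V} (e : Arc G) : V := e.1.2

/-- A choice, for every two consecutive edges `e = (u, v)`, `f = (v, w)`, of one of the edges
`φ` (`false`) or `ψ` (`true`) of the copy `D_e`, to which the edge `ω` of `D_f` will be glued.
It is admissible if for fixed `e` different edges `f` get different edges of `D_e`. Only values
at consecutive edges matter. -/
def IsAdmissible {G : Digraph V} (port : Arc G → Arc G → Bool) : Prop :=
  ∀ e f g : Arc G, e.head = f.tail → e.head = g.tail → f ≠ g → port e f ≠ port e g

/-- The identifications on the vertices of the disjoint union of the copies `D_e`. At a vertex
`v` of `G`, the vertices `s_f` for `f` leaving `v` and `t_e` for `e` entering `v` become one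
vertex; and for `e` entering and `f` leaving `v`, the edge `ω_f = s_f a_f` is identified with
`φ_e = t_e b_e` or with `ψ_e = t_e c_e`. -/
inductive Glue {G : Digraph V} (port : Arc G → Arc G → Bool) :
    Arc G × DunceVertex → Arc G × DunceVertex → Prop
  | tails (e f : Arc G) (h : e.tail = f.tail) : Glue port (e, DunceVertex.s) (f, DunceVertex.s)
  | heads (e f : Arc G) (h : e.head = f.head) : Glue port (e, DunceVertex.t) (f, DunceVertex.t)
  | pass (e f : Arc G) (h : e.head = f.tail) : Glue port (e, DunceVertex.t) (f, DunceVertex.s)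
  | tip (e f : Arc G) (h : e.head = f.tail) :
      Glue port (e, portVertex (port e f)) (f, DunceVertex.a)

/-- The vertices of `K(G)`: the quotient of the vertices of the disjoint union of the copies
`D_e` by the equivalence relation generated by `Glue`. -/
def KVertex {G : Digraph V} (port : Arc G → Arc G → Bool) : Type _ := Quot (Glue port)

/-- The map from the copy `D_e` to `K(G)`, on vertices. -/
def copyMap {G : Digraph V} (port : Arc G → Arc G → Bool) (e : Arc G) (z : DunceVertex) :
    KVertex port :=
  Quot.mk (Glue port) (e, z)

open Classical in
/-- The simplicial complex `K(G)`: the union of the images of the copies `D_e`, one for each edge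
`e` of `G`, after the identification. -/
noncomputable def complexOf {G : Digraph V} (port : Arc G → Arc G → Bool) :
    PreAbstractSimplicialComplex (KVertex port) where
  faces := {σ | ∃ e : Arc G, ∃ τ ∈ dunceHat, σ = τ.image (copyMap port e)}
  isRelLowerSet_faces := by
    rintro σ ⟨e, τ, hτ, rfl⟩
    refine ⟨Finset.image_nonempty.mpr (dunceHat.isRelLowerSet_faces hτ).1, fun ρ hρ hne => ?_⟩
    obtain ⟨τ', hτ', rfl⟩ := Finset.subset_image_iff.mp hρ
    exact ⟨e, τ', (dunceHat.isRelLowerSet_faces hτ).2 hτ' (Finset.image_nonempty.mp hne), rfl⟩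

/-- Admissible choices exist for every finite directed degree-3 graph. -/
theorem exists_isAdmissible [Finite V] (G : Digraph V) (hdeg : IsDegreeThree G) :
    ∃ port : Arc G → Arc G → Bool, IsAdmissible port := by
  classical
  have key : ∀ v : V, {u | G.Adj u v}.Nonempty →
      ∃ p : V → Bool, Set.InjOn p {w | G.Adj v w} := by
    intro v hv
    have h1 : 0 < {u | G.Adj u v}.ncard := (Set.ncard_pos (Set.toFinite _)).mpr hv
    have h2 : {w | G.Adj v w}.ncard ≤ 2 := by have := hdeg v; omega
    by_cases hne : {w | G.Adj v w}.Nonempty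
    · obtain ⟨w₀, hw₀⟩ := hne
      refine ⟨fun w => decide (w = w₀), fun w hw w' hw' hww => ?_⟩
      by_contra hne
      have hsub : ({w₀, w, w'} : Set V) ⊆ {w | G.Adj v w} := by
        rintro z (rfl | rfl | rfl) <;> assumption
      have hw0 : w₀ ≠ w := by
        rintro rfl
        simp only [decide_true] at hww
        exact hne (of_decide_eq_true hww.symm).symm
      have hw1 : w₀ ≠ w' := by
        rintro rfl
        simp only [decide_true] at hww
        exact hne (of_decide_eq_true hww)
      have := Set.ncard_le_ncard hsub (Set.toFinite _)
      rw [Set.ncard_eq_three.mpr ⟨w₀, w, w', hw0, hw1, hne, rfl⟩] at this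
      omega
    · exact ⟨fun _ => false, fun w hw => absurd ⟨w, hw⟩ hne⟩
  choose p hp using key
  refine ⟨fun e f => p e.1.2 ⟨e.1.1, e.2⟩ f.1.2, fun e f g hf hg hfg heq => hfg ?_⟩
  have hf' : G.Adj e.1.2 f.1.2 := by
    have : e.1.2 = f.1.1 := hf
    rw [this]; exact f.2
  have hg' : G.Adj e.1.2 g.1.2 := by
    have : e.1.2 = g.1.1 := hg
    rw [this]; exact g.2
  have h2 := hp e.1.2 ⟨e.1.1, e.2⟩ hf' hg' heq
  exact Subtype.ext (Prod.ext (hf.symm.trans hg) h2)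

end Construction

/-! ### Collapsing complexes of dimension at most two -/

section Erasability

variable {W : Type*}

/-! The hat `D` has the single free edge `ω`. Its triangles can be collapsed one after another
starting from `Γ` through `ω`; the same order works from the second triangle on if `Γ` has been
deleted. In `K(G)` the edge `ω_e` is covered by the copies of the arcs entering the tail of `e`, so
`D_e` can be entered only after those copies have released it. Erasing thus follows a topological
order of the arcs, directed cycles are the only obstruction, and deleting `Γ_e` has the effect of
deleting `e`.

Erasability is tested by sets of triangles: it holds if every nonempty set has a member with an edge
in no other member (`isErasable_of_forall_exists_edge`), and fails if some nonempty set covers all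
proper faces of its members twice (`not_isErasable_of_no_free_face`). For the upper bound
(`isErasable_removeFaces`), delete `Γ_e` for `e` in a feedback arc set and order the remaining
triangles by the height of the arc, then by position in the hat. For the lower bound
(`isAcyclicDigraph_of_isErasable`), a cycle avoiding all copies hit by the deletion yields a doubly
covered set.

Both need control over the gluing: no collapsing edge except `ω` is shared between copies
(`eq_of_nameOf_exit_eq`), so a triangle determines its arc. Invariants on the quotient, the vertex
names, prove this. -/

theorem PreAbstractSimplicialComplex.mem_of_subset {K : PreAbstractSimplicialComplex W}
    {σ τ : Finset W} (hτ : τ ∈ K) (hστ : σ ⊆ τ) (hσ : σ.Nonempty) : σ ∈ K :=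
  (K.isRelLowerSet_faces hτ).2 hστ hσ

theorem mem_removeFaces {K : PreAbstractSimplicialComplex W} {C : Set (Finset W)}
    {σ : Finset W} : σ ∈ removeFaces K C ↔ σ ∈ K ∧ ∀ c ∈ C, ¬ c ⊆ σ :=
  Iff.rfl

/-- A set of triangles in which every proper face of a member lies in another member is not
affected by an elementary collapse. -/
theorem ElementaryCollapse.subset_of_no_free_face {K L : PreAbstractSimplicialComplex W}
    (h : ElementaryCollapse K L) (hdim : ∀ ρ ∈ K, ρ.card ≤ 3) {S : Set (Finset W)}
    (hS : ∀ τ ∈ S, τ.card = 3)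
    (hfree : ∀ τ ∈ S, ∀ σ : Finset W, σ.Nonempty → σ ⊂ τ → ∃ τ' ∈ S, τ' ≠ τ ∧ σ ⊆ τ')
    (hSK : ∀ τ ∈ S, τ ∈ K) : ∀ τ ∈ S, τ ∈ L := by
  obtain ⟨-, σ, τ, hστ, hdiff⟩ := h
  have hσ : σ ∈ K.faces \ L.faces := hdiff ▸ Or.inl rfl
  have hτ : τ ∈ K.faces \ L.faces := hdiff ▸ Or.inr rfl
  intro T hT
  by_contra hTL
  have hT' : T ∈ ({σ, τ} : Set (Finset W)) := hdiff ▸ ⟨hSK T hT, hTL⟩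
  have hlt := Finset.card_lt_card hστ
  rcases hT' with rfl | rfl
  -- The smaller simplex of the pair cannot be a triangle, since the larger one would have at least
  -- four vertices.
  · have := hS _ hT
    have := hdim τ hτ.1
    omega
  -- Losing `σ` forces the loss of every simplex above it, including a second triangle of `S`, but
  -- only two simplices disappear.
  · obtain ⟨T', hT', hne, hsub⟩ := hfree _ hT σ (K.isRelLowerSet_faces hσ.1).1 hστ
    have hT'L : T' ∉ L := fun hL =>
      hσ.2 (PreAbstractSimplicialComplex.mem_of_subset hL hsub (K.isRelLowerSet_faces hσ.1).1)
    have hmem : T' ∈ ({σ, T} : Set (Finset W)) := hdiff ▸ ⟨hSK T' hT', hT'L⟩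
    rcases hmem with rfl | rfl
    · have := hS _ hT
      have := hS _ hT'
      omega
    · exact hne rfl

/-- A complex containing a nonempty set of triangles in which every proper face of a member lies
in another member is not erasable. -/
theorem not_isErasable_of_no_free_face {K : PreAbstractSimplicialComplex W}
    (hdim : ∀ ρ ∈ K, ρ.card ≤ 3) {S : Set (Finset W)} (hne : S.Nonempty)
    (hS : ∀ τ ∈ S, τ.card = 3)
    (hfree : ∀ τ ∈ S, ∀ σ : Finset W, σ.Nonempty → σ ⊂ τ → ∃ τ' ∈ S, τ' ≠ τ ∧ σ ⊆ τ')
    (hSK : ∀ τ ∈ S, τ ∈ K) : ¬ IsErasable K := by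
  rintro ⟨L, hKL, hL⟩
  have key : (∀ ρ ∈ L, ρ.card ≤ 3) ∧ ∀ τ ∈ S, τ ∈ L := by
    clear hL
    induction hKL with
    | refl => exact ⟨hdim, hSK⟩
    | tail _ hstep ih =>
      exact ⟨fun ρ hρ => ih.1 ρ (hstep.1 hρ), hstep.subset_of_no_free_face ih.1 hS hfree ih.2⟩
  obtain ⟨T, hT⟩ := hne
  have := hL T (key.2 T hT)
  have := hS T hT
  omega

/-- A complex of dimension at most two is erasable if every nonempty set of its triangles has a
member with an edge that lies in no other member. -/
theorem isErasable_of_forall_exists_edge {K : PreAbstractSimplicialComplex W}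
    (hdim : ∀ ρ ∈ K, ρ.card ≤ 3) (hfin : {τ | τ ∈ K ∧ τ.card = 3}.Finite)
    (h : ∀ S ⊆ {τ | τ ∈ K ∧ τ.card = 3}, S.Nonempty →
      ∃ τ ∈ S, ∃ σ ⊂ τ, σ.card = 2 ∧ ∀ τ' ∈ S, σ ⊆ τ' → τ' = τ) : IsErasable K := by
  induction hn : {τ | τ ∈ K ∧ τ.card = 3}.ncard using Nat.strong_induction_on generalizing K with
  | _ n ih =>
  rcases Set.eq_empty_or_nonempty {τ | τ ∈ K ∧ τ.card = 3} with hempty | hne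
  · refine ⟨K, Relation.ReflTransGen.refl, fun σ hσ => ?_⟩
    have h1 := hdim σ hσ
    have h2 : σ.card ≠ 3 := fun h3 => (Set.ext_iff.mp hempty σ).mp ⟨hσ, h3⟩
    omega
  · obtain ⟨τ, hτ, σ, hστ, hσ, huniq⟩ := h _ subset_rfl hne
    have hσne : σ.Nonempty := Finset.card_pos.mp (by omega)
    -- The simplices above `σ` are just `σ` and `τ`, so deleting `σ` is a collapse. The hypothesis
    -- on sets of triangles passes to the smaller complex.
    have hle : ∀ ρ ∈ removeFaces K {σ}, ρ ∈ K := fun ρ hρ => hρ.1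
    have hcoll : ElementaryCollapse K (removeFaces K {σ}) := by
      refine ⟨hle, σ, τ, hστ, ?_⟩
      ext ρ
      constructor
      · rintro ⟨hρ, hρ'⟩
        have hsub : σ ⊆ ρ := by
          by_contra hns
          exact hρ' ⟨hρ, by rintro c rfl; exact hns⟩
        by_cases h3 : ρ.card = 3
        · exact Or.inr (huniq ρ ⟨hρ, h3⟩ hsub)
        · have := hdim ρ hρ
          exact Or.inl (Finset.eq_of_subset_of_card_le hsub (by omega)).symm
      · rintro (rfl | rfl)
        · exact ⟨K.mem_of_subset hτ.1 hστ.1 hσne, fun h => h.2 _ rfl subset_rfl⟩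
        · exact ⟨hτ.1, fun h => h.2 _ rfl hστ.1⟩
    have hsub : {τ | τ ∈ removeFaces K {σ} ∧ τ.card = 3} ⊆ {τ | τ ∈ K ∧ τ.card = 3} :=
      fun ρ hρ => ⟨hle ρ hρ.1, hρ.2⟩
    have hlt : {τ | τ ∈ removeFaces K {σ} ∧ τ.card = 3}.ncard < n := by
      rw [← hn]
      exact Set.ncard_lt_ncard ⟨hsub, fun hsup => (hsup hτ).1.2 σ rfl hστ.1⟩ hfin
    obtain ⟨L, hL, hLd⟩ := ih _ hlt (fun ρ hρ => hdim ρ (hle ρ hρ)) (hfin.subset hsub)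
      (fun S hS hSne => h S (hS.trans hsub) hSne) rfl
    exact ⟨L, hL.head hcoll, hLd⟩

end Erasability

/-! ### Feedback arc sets and acyclic digraphs -/

section DirectedGraphs

variable {V : Type*}

theorem exists_isFeedbackArcSet_card_eq_optMinFAS [Finite V] (G : Digraph V) :
    ∃ F : Finset (V × V), IsFeedbackArcSet G F ∧ F.card = optMinFAS G := by
  refine Nat.sInf_mem (s := {k | ∃ F : Finset (V × V), IsFeedbackArcSet G F ∧ F.card = k}) ?_
  -- The set of all arcs is a feedback arc set, so the infimum is attained rather than being the
  -- default value 0 of `sInf` at the empty set.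
  have hfin : {p : V × V | G.Adj p.1 p.2}.Finite := Set.toFinite _
  refine ⟨_, hfin.toFinset, ⟨fun p hp => by simpa using hp, fun v hv => ?_⟩, rfl⟩
  obtain ⟨w, -, hw⟩ := Relation.TransGen.tail'_iff.mp hv
  exact hw.2 (by simpa using hw.1)

theorem optMinFAS_le_card {G : Digraph V} {F : Finset (V × V)} (hF : IsFeedbackArcSet G F) :
    optMinFAS G ≤ F.card :=
  Nat.sInf_le ⟨F, hF, rfl⟩

/-- In a minimum feedback arc set the tail of every arc is the head of some arc. -/
theorem IsFeedbackArcSet.exists_adj_tail {G : Digraph V} {F : Finset (V × V)}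
    (hF : IsFeedbackArcSet G F) (hmin : F.card = optMinFAS G) {p : V × V} (hp : p ∈ F) :
    ∃ u, G.Adj u p.1 := by
  classical
  by_contra! hno
  have hfas : IsFeedbackArcSet G (F.erase p) := by
    refine ⟨fun q hq => hF.1 q (Finset.mem_of_mem_erase hq), fun v hv => hF.2 v ?_⟩
    -- Every vertex on a closed walk has an entering arc, so the walk never uses `p` and already
    -- avoids all of `F`.
    have hstep : ∀ x y, (∃ u, G.Adj u x) → (deleteArcs G (F.erase p)).Adj x y →
        (deleteArcs G F).Adj x y := by
      rintro x y ⟨u, hu⟩ ⟨hxy, hxyF⟩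
      refine ⟨hxy, fun hmem => hxyF (Finset.mem_erase.mpr ⟨?_, hmem⟩)⟩
      rintro rfl
      exact hno u hu
    have hin : ∃ u, G.Adj u v := by
      obtain ⟨w, -, hw⟩ := Relation.TransGen.tail'_iff.mp hv
      exact ⟨w, hw.1⟩
    have : ∀ z, Relation.TransGen (deleteArcs G (F.erase p)).Adj v z →
        Relation.TransGen (deleteArcs G F).Adj v z ∧ ∃ u, G.Adj u z := by
      intro z hz
      induction hz with
      | single h => exact ⟨.single (hstep _ _ hin h), _, h.1⟩
      | tail _ h ih => exact ⟨ih.1.tail (hstep _ _ ih.2 h), _, h.1⟩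
    exact (this v hv).1
  have h1 := optMinFAS_le_card hfas
  have h2 := Finset.card_erase_lt_of_mem hp
  omega

/-- A finite acyclic directed graph has a height function increasing along the edges. -/
theorem IsAcyclicDigraph.exists_height [Finite V] {G : Digraph V} (hG : IsAcyclicDigraph G) :
    ∃ N : V → ℕ, ∀ u v, G.Adj u v → N u < N v := by
  -- The height counts the vertices from which `v` is reachable; acyclicity makes the inclusion
  -- strict, as `u` is not its own ancestor.
  refine ⟨fun v => {u | Relation.TransGen G.Adj u v}.ncard, fun u v huv => ?_⟩
  refine Set.ncard_lt_ncard ⟨fun w hw => hw.tail huv, fun hsub => ?_⟩ (Set.toFinite _)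
  exact hG u (hsub (Relation.TransGen.single huv))

/-- A directed graph with a cycle has a nonempty
set of vertices, each the head of an arc whose tail lies in the set. -/
theorem exists_set_of_not_isAcyclicDigraph {G : Digraph V} (hG : ¬ IsAcyclicDigraph G) :
    ∃ A : Set V, A.Nonempty ∧ ∀ v ∈ A, ∃ u ∈ A, G.Adj u v := by
  simp only [IsAcyclicDigraph, not_forall, not_not] at hG
  obtain ⟨v, hv⟩ := hG
  refine ⟨{w | Relation.TransGen G.Adj v w}, ⟨v, hv⟩, fun w hw => ?_⟩
  obtain ⟨u, hu, huw⟩ := Relation.TransGen.tail'_iff.mp hw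
  exact ⟨u, hv.trans_left hu, huw⟩

end DirectedGraphs

/-! ### Combinatorics of a single dunce hat -/

section DunceHat

/-- The triangles of the modified dunce hat, in an order in which they can be collapsed. -/
def dunceTriangle : Fin 13 → Finset DunceVertex :=
  open DunceVertex in
  ![{s, a, y}, {s, x, y}, {a, y, b}, {x, y, c}, {y, t, c}, {y, b, t}, {a, x, c}, {a, t, c},
    {a, x, t}, {s, x, t}, {s, b, t}, {s, x, b}, {a, x, b}]

/-- The first end of the edge through which `dunceTriangle i` is collapsed. -/
def exitLeft : Fin 13 → DunceVertex :=
  open DunceVertex in ![s, s, a, x, y, y, x, a, a, x, s, s, x]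

/-- The second end of the edge through which `dunceTriangle i` is collapsed. -/
def exitRight : Fin 13 → DunceVertex :=
  open DunceVertex in ![a, y, y, y, c, t, c, c, t, t, t, b, b]

set_option maxRecDepth 100000 in
theorem dunceTriangle_mem (i : Fin 13) : dunceTriangle i ∈ dunceFacets := by
  decide +revert

set_option maxRecDepth 100000 in
theorem exists_dunceTriangle_eq : ∀ τ ∈ dunceFacets, ∃ i, dunceTriangle i = τ := by
  decide

theorem exitLeft_mem (i : Fin 13) : exitLeft i ∈ dunceTriangle i := by
  decide +revert

theorem exitRight_mem (i : Fin 13) : exitRight i ∈ dunceTriangle i := by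
  decide +revert

theorem exitLeft_ne_exitRight (i : Fin 13) : exitLeft i ≠ exitRight i := by
  decide +revert

set_option maxRecDepth 100000 in
-- This is what makes the order a collapsing order: once the triangles before number `i` are gone,
-- its exit edge is free within the hat.
theorem le_of_exit_mem : ∀ i j : Fin 13, exitLeft i ∈ dunceTriangle j →
    exitRight i ∈ dunceTriangle j → j ≤ i := by
  decide

set_option maxRecDepth 100000 in
-- Used to recover the arc from a triangle: exit edges with `i ≠ 0`, that is, other than `ω`, are
-- not shared between copies.
theorem exists_exit_mem : ∀ τ ∈ dunceFacets,
    ∃ i : Fin 13, i ≠ 0 ∧ exitLeft i ∈ τ ∧ exitRight i ∈ τ := by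
  decide

set_option maxRecDepth 100000 in
theorem card_of_mem_dunceFacets : ∀ τ ∈ dunceFacets, τ.card = 3 := by
  decide

set_option maxRecDepth 100000 in
/-- Every proper face of a triangle of the dunce hat lies in another triangle, except for the
edge `ω`. -/
theorem exists_other_facet : ∀ τ ∈ dunceFacets, ∀ σ ∈ τ.powerset, σ.Nonempty → σ ≠ τ →
    σ ≠ {DunceVertex.s, DunceVertex.a} → ∃ τ' ∈ dunceFacets, τ' ≠ τ ∧ σ ⊆ τ' := by
  decide

theorem exists_facet_port : ∀ p : Bool, ∃ τ ∈ dunceFacets,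
    DunceVertex.t ∈ τ ∧ portVertex p ∈ τ := by
  decide

end DunceHat

/-! ### Vertex names as invariants of the gluing -/

section Construction

variable {V : Type*} {G : Digraph V} {port : Arc G → Arc G → Bool}

theorem Arc.adj (e : Arc G) : G.Adj e.tail e.head := e.2

theorem Arc.ext {e f : Arc G} (ht : e.tail = f.tail) (hh : e.head = f.head) : e = f :=
  Subtype.ext (Prod.ext ht hh)

instance [Finite V] : Finite (Arc G) :=
  inferInstanceAs (Finite {p : V × V // G.Adj p.1 p.2})

theorem IsOrientedGraph.tail_ne_head (hG : IsOrientedGraph G) (e : Arc G) : e.tail ≠ e.head := by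
  intro h
  have h1 := e.adj
  have h2 := hG _ _ h1
  rw [h] at h1 h2
  exact h2 h1

theorem IsOrientedGraph.not_reverse (hG : IsOrientedGraph G) (e f : Arc G)
    (h1 : e.tail = f.head) (h2 : e.head = f.tail) : False := by
  have he := e.adj
  rw [h1, h2] at he
  exact hG _ _ f.adj he

/-- Names for the vertices of `K(G)`: one for every vertex of `G`, one for the vertex `a` of
every copy, and names for the vertices that are not identified with any other. -/
inductive VertexName (G : Digraph V) : Type _
  | node (v : V)
  | tip (f : Arc G)
  | own (e : Arc G) (z : DunceVertex)

open Classical in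
/-- The name of the vertex `b` (for `false`) or `c` (for `true`) of the copy `D_e`. -/
noncomputable def portName (port : Arc G → Arc G → Bool) (e : Arc G) (p : Bool) : VertexName G :=
  if h : ∃ f : Arc G, e.head = f.tail ∧ port e f = p then .tip h.choose
  else .own e (portVertex p)

/-- The name of the vertex `z` of the copy `D_e`. -/
noncomputable def nameOf (port : Arc G → Arc G → Bool) (e : Arc G) : DunceVertex → VertexName G
  | .s => .node e.tail
  | .t => .node e.head
  | .a => .tip e
  | .b => portName port e false
  | .c => portName port e true
  | .x => .own e .x
  | .y => .own e .y

theorem portName_cases (port : Arc G → Arc G → Bool) (e : Arc G) (p : Bool) :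
    (∃ f : Arc G, e.head = f.tail ∧ port e f = p ∧ portName port e p = .tip f) ∨
      portName port e p = .own e (portVertex p) := by
  unfold portName
  split_ifs with h
  · exact Or.inl ⟨h.choose, h.choose_spec.1, h.choose_spec.2, rfl⟩
  · exact Or.inr rfl

/-- Admissibility leaves only one arc that can be glued to a given port, so the arbitrary choice in
`portName` must return `f`. -/
theorem portName_eq_tip (hport : IsAdmissible port) {e f : Arc G} (h : e.head = f.tail) :
    portName port e (port e f) = .tip f := by
  have hex : ∃ g : Arc G, e.head = g.tail ∧ port e g = port e f := ⟨f, h, rfl⟩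
  unfold portName
  rw [dif_pos hex]
  by_contra hne
  exact hport e hex.choose f hex.choose_spec.1 h (fun heq => hne (by rw [heq]))
    hex.choose_spec.2

theorem nameOf_portVertex (e : Arc G) (p : Bool) :
    nameOf port e (portVertex p) = portName port e p := by
  cases p <;> rfl

/-- Names are constant along the generating identifications, hence descend to the quotient; distinct
names then certify distinct vertices of `K(G)`. -/
theorem nameOf_eq_of_glue (hport : IsAdmissible port) {p q : Arc G × DunceVertex}
    (h : Glue port p q) : nameOf port p.1 p.2 = nameOf port q.1 q.2 := by
  cases h with
  | tails e f h => simp [nameOf, h]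
  | heads e f h => simp [nameOf, h]
  | pass e f h => simp [nameOf, h]
  | tip e f h => rw [nameOf_portVertex, portName_eq_tip hport h]; rfl

theorem nameOf_eq_of_copyMap_eq (hport : IsAdmissible port) {e f : Arc G} {z w : DunceVertex}
    (h : copyMap port e z = copyMap port f w) : nameOf port e z = nameOf port f w :=
  congrArg (Quot.lift (fun p : Arc G × DunceVertex => nameOf port p.1 p.2)
    fun _ _ hpq => nameOf_eq_of_glue hport hpq) h

/-- Since there are no loops, `s` differs from `t`, and `a` from `b` and `c`. The vertices `b` and
`c` differ because an arc is glued to only one port. -/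
theorem nameOf_injective (hG : IsOrientedGraph G) (e : Arc G) :
    Function.Injective (nameOf port e) := by
  have hne := hG.tail_ne_head e
  have hb := portName_cases port e false
  have hc := portName_cases port e true
  intro z w h
  cases z <;> cases w <;> simp only [nameOf] at h <;>
    grind [portVertex]

theorem copyMap_injective (hG : IsOrientedGraph G) (hport : IsAdmissible port) (e : Arc G) :
    Function.Injective (copyMap port e) :=
  fun _ _ h => nameOf_injective hG e (nameOf_eq_of_copyMap_eq hport h)

theorem nameOf_eq_node {e : Arc G} {z : DunceVertex} {v : V} (h : nameOf port e z = .node v) :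
    e.tail = v ∨ e.head = v := by
  have hb := portName_cases port e false
  have hc := portName_cases port e true
  cases z <;> simp only [nameOf] at h <;> grind

theorem nameOf_eq_tip {e f : Arc G} {z : DunceVertex} (h : nameOf port e z = .tip f) :
    e = f ∨ e.head = f.tail := by
  have hb := portName_cases port e false
  have hc := portName_cases port e true
  cases z <;> simp only [nameOf] at h <;> grind

theorem nameOf_eq_own {e f : Arc G} {z w : DunceVertex} (h : nameOf port e z = .own f w) :
    e = f := by
  have hb := portName_cases port e false
  have hc := portName_cases port e true
  cases z <;> simp only [nameOf] at h <;> grind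

/-- The edges other than `ω` through which triangles are collapsed lie only in one copy. -/
theorem eq_of_nameOf_exit_eq (hG : IsOrientedGraph G) {e f : Arc G} {i : Fin 13} (hi : i ≠ 0)
    {z w : DunceVertex} (hz : nameOf port f z = nameOf port e (exitLeft i))
    (hw : nameOf port f w = nameOf port e (exitRight i)) : f = e := by
  have hb := portName_cases port e false
  have hc := portName_cases port e true
  have hne := hG.tail_ne_head
  have hrev := hG.not_reverse
  have hext := @Arc.ext V G
  fin_cases i <;> simp [exitLeft, exitRight] at hi hz hw
  · exact nameOf_eq_own hw
  · exact nameOf_eq_own hw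
  · exact nameOf_eq_own hw
  · exact nameOf_eq_own hz
  · exact nameOf_eq_own hz
  · exact nameOf_eq_own hz
  -- Exit edges through `x` or `y` are settled by that private vertex. For the others, `ac`, `at`,
  -- `st` and `sb`, a different copy containing both ends would produce a loop or a 2-cycle.
  · have h1 := nameOf_eq_tip hz
    rcases hc with ⟨g, hg, -, hc⟩ | hc
    · have h2 := nameOf_eq_tip (hw.trans hc)
      grind
    · exact nameOf_eq_own (hw.trans hc)
  · have h1 := nameOf_eq_tip hz
    have h2 := nameOf_eq_node hw
    grind
  · exact nameOf_eq_own hz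
  · have h1 := nameOf_eq_node hz
    have h2 := nameOf_eq_node hw
    grind
  · have h1 := nameOf_eq_node hz
    rcases hb with ⟨g, hg, -, hb⟩ | hb
    · have h2 := nameOf_eq_tip (hw.trans hb)
      grind
    · exact nameOf_eq_own (hw.trans hb)
  · exact nameOf_eq_own hz

/-! ### Triangles of the glued complex -/

open Classical in
/-- The image in `K(G)` of a set of vertices of the copy `D_e`. -/
noncomputable def copyFace (port : Arc G → Arc G → Bool) (e : Arc G) (τ : Finset DunceVertex) :
    Finset (KVertex port) :=
  τ.image (copyMap port e)

theorem copyFace_mono (e : Arc G) {σ τ : Finset DunceVertex} (h : σ ⊆ τ) :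
    copyFace port e σ ⊆ copyFace port e τ := by
  classical exact Finset.image_subset_image h

theorem mem_copyFace {e : Arc G} {τ : Finset DunceVertex} {z : KVertex port} :
    z ∈ copyFace port e τ ↔ ∃ w ∈ τ, copyMap port e w = z := by
  simp [copyFace]

theorem copyMap_mem_copyFace (e : Arc G) {τ : Finset DunceVertex} {w : DunceVertex} (h : w ∈ τ) :
    copyMap port e w ∈ copyFace port e τ :=
  mem_copyFace.mpr ⟨w, h, rfl⟩

theorem card_copyFace (hG : IsOrientedGraph G) (hport : IsAdmissible port) (e : Arc G)
    (τ : Finset DunceVertex) : (copyFace port e τ).card = τ.card := by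
  classical exact Finset.card_image_of_injective _ (copyMap_injective hG hport e)

theorem copyFace_injective (hG : IsOrientedGraph G) (hport : IsAdmissible port) (e : Arc G) :
    Function.Injective (copyFace port e) := by
  classical exact Finset.image_injective (copyMap_injective hG hport e)

theorem mem_of_copyMap_mem_copyFace (hG : IsOrientedGraph G) (hport : IsAdmissible port)
    {e : Arc G} {τ : Finset DunceVertex} {z : DunceVertex}
    (h : copyMap port e z ∈ copyFace port e τ) : z ∈ τ := by
  obtain ⟨w, hw, hwz⟩ := mem_copyFace.mp h
  exact copyMap_injective hG hport e hwz ▸ hw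

theorem copyFace_mem_complexOf (e : Arc G) {τ : Finset DunceVertex} (hτ : τ ∈ dunceFacets) :
    copyFace port e τ ∈ complexOf port :=
  ⟨e, τ, ⟨Finset.card_pos.mp (by rw [card_of_mem_dunceFacets τ hτ]; norm_num), τ, hτ, subset_rfl⟩,
    rfl⟩

theorem card_le_three_of_mem_complexOf {σ : Finset (KVertex port)} (hσ : σ ∈ complexOf port) :
    σ.card ≤ 3 := by
  classical
  obtain ⟨e, τ, ⟨-, τ', hτ', hsub⟩, rfl⟩ := hσ
  rw [← card_of_mem_dunceFacets τ' hτ']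
  exact Finset.card_image_le.trans (Finset.card_le_card hsub)

theorem exists_eq_copyFace {σ : Finset (KVertex port)} (hσ : σ ∈ complexOf port)
    (h3 : σ.card = 3) : ∃ e : Arc G, ∃ τ ∈ dunceFacets, σ = copyFace port e τ := by
  classical
  obtain ⟨e, τ, ⟨-, τ', hτ', hsub⟩, rfl⟩ := hσ
  have h1 : 3 ≤ τ.card := h3.symm.le.trans Finset.card_image_le
  have h2 := card_of_mem_dunceFacets τ' hτ'
  rw [← Finset.eq_of_subset_of_card_le hsub (by omega)] at hτ'
  exact ⟨e, τ, hτ', rfl⟩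

/-- An edge other than `ω` through which a triangle is collapsed lies only in one copy. -/
theorem eq_of_exit_mem_copyFace (hG : IsOrientedGraph G) (hport : IsAdmissible port)
    {e f : Arc G} {i : Fin 13} (hi : i ≠ 0) {τ : Finset DunceVertex}
    (hl : copyMap port e (exitLeft i) ∈ copyFace port f τ)
    (hr : copyMap port e (exitRight i) ∈ copyFace port f τ) : f = e := by
  obtain ⟨z, -, hz⟩ := mem_copyFace.mp hl
  obtain ⟨w, -, hw⟩ := mem_copyFace.mp hr
  exact eq_of_nameOf_exit_eq hG hi (nameOf_eq_of_copyMap_eq hport hz)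
    (nameOf_eq_of_copyMap_eq hport hw)

theorem eq_of_copyFace_eq (hG : IsOrientedGraph G) (hport : IsAdmissible port) {e f : Arc G}
    {τ τ' : Finset DunceVertex} (hτ : τ ∈ dunceFacets)
    (h : copyFace port e τ = copyFace port f τ') : f = e := by
  obtain ⟨i, hi, hl, hr⟩ := exists_exit_mem τ hτ
  exact eq_of_exit_mem_copyFace hG hport hi (h ▸ copyMap_mem_copyFace e hl)
    (h ▸ copyMap_mem_copyFace e hr)

/-- The edge `ω` of a copy lies in a triangle of the copy for any preceding arc. -/
theorem exists_facet_of_head_eq_tail {e f : Arc G} (h : f.head = e.tail) :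
    ∃ τ ∈ dunceFacets, copyFace port e {DunceVertex.s, DunceVertex.a} ⊆ copyFace port f τ := by
  obtain ⟨τ, hτ, ht, hp⟩ := exists_facet_port (port f e)
  refine ⟨τ, hτ, fun z hz => ?_⟩
  obtain ⟨w, hw, rfl⟩ := mem_copyFace.mp hz
  rcases Finset.mem_insert.mp hw with rfl | hw
  · rw [show copyMap port e .s = copyMap port f .t from (Quot.sound (Glue.pass f e h)).symm]
    exact copyMap_mem_copyFace f ht
  · rw [Finset.mem_singleton.mp hw, show copyMap port e .a = copyMap port f (portVertex (port f e))
      from (Quot.sound (Glue.tip f e h)).symm]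
    exact copyMap_mem_copyFace f hp

/-- Every proper face of a triangle of a copy that has a preceding arc lies in another triangle
of this copy or in a triangle of the copy for the preceding arc. -/
theorem exists_other_copyFace (hG : IsOrientedGraph G) (hport : IsAdmissible port) {e f : Arc G}
    (h : f.head = e.tail) {τ : Finset DunceVertex} (hτ : τ ∈ dunceFacets)
    {σ : Finset (KVertex port)} (hne : σ.Nonempty) (hσ : σ ⊂ copyFace port e τ) :
    ∃ g, (g = e ∨ g = f) ∧ ∃ τ' ∈ dunceFacets, copyFace port g τ' ≠ copyFace port e τ ∧
      σ ⊆ copyFace port g τ' := by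
  classical
  obtain ⟨σ, hsub, rfl⟩ := Finset.subset_image_iff.mp hσ.1
  by_cases hω : σ = {DunceVertex.s, DunceVertex.a}
  · obtain ⟨τ', hτ', hsub'⟩ := exists_facet_of_head_eq_tail (port := port) h
    -- If the two triangles coincided, so would their arcs, making `e` a loop.
    refine ⟨f, Or.inr rfl, τ', hτ', fun heq => ?_, ?_⟩
    · rw [eq_of_copyFace_eq hG hport hτ' heq] at h
      exact hG.tail_ne_head f h.symm
    · rw [hω]
      convert hsub'
      simp [copyFace]
  · obtain ⟨τ', hτ', hne', hsub'⟩ := exists_other_facet τ hτ σ (Finset.mem_powerset.mpr hsub)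
      (Finset.image_nonempty.mp hne) (by rintro rfl; exact hσ.2 (by simp [copyFace])) hω
    refine ⟨e, Or.inl rfl, τ', hτ', fun heq => hne' (copyFace_injective hG hport e heq), ?_⟩
    convert copyFace_mono e hsub'
    simp [copyFace]

/-! ### Feedback arc sets versus erasing sets of triangles -/

/-- Removing the triangles `Γ_e` for the arcs `e` of a feedback arc set makes `K(G)` erasable. -/
theorem isErasable_removeFaces [Finite V] (hG : IsOrientedGraph G) (hport : IsAdmissible port)
    {F : Finset (V × V)} (hF : IsFeedbackArcSet G F) {C : Set (Finset (KVertex port))}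
    (hC : ∀ e : Arc G, (e.tail, e.head) ∈ F → copyFace port e (dunceTriangle 0) ∈ C) :
    IsErasable (removeFaces (complexOf port) C) := by
  classical
  obtain ⟨N, hN⟩ := hF.2.exists_height
  -- Arcs of `F` get rank 0 because their copies, with `Γ` deleted, can be collapsed without waiting
  -- for others; the shift by 1 puts all other arcs above them.
  let rank : Arc G → ℕ := fun e => if (e.tail, e.head) ∈ F then 0 else N e.tail + 1
  have hrank : ∀ e f : Arc G, (e.tail, e.head) ∉ F → f.head = e.tail → rank f < rank e := by
    intro e f he hfe
    by_cases hf : (f.tail, f.head) ∈ F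
    · simp [rank, he, hf]
    · have := hN _ _ (show (deleteArcs G F).Adj f.tail f.head from ⟨f.adj, hf⟩)
      simp only [rank, if_neg he, if_neg hf]
      rw [hfe] at this
      omega
  have hmem : ∀ σ ∈ removeFaces (complexOf port) C, σ ∈ complexOf port := fun σ hσ => hσ.1
  have htri : ∀ σ, σ ∈ removeFaces (complexOf port) C → σ.card = 3 →
      ∃ q : Arc G × Fin 13, copyFace port q.1 (dunceTriangle q.2) = σ := by
    intro σ hσ h3
    obtain ⟨e, τ, hτ, rfl⟩ := exists_eq_copyFace (hmem σ hσ) h3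
    obtain ⟨i, rfl⟩ := exists_dunceTriangle_eq τ hτ
    exact ⟨(e, i), rfl⟩
  refine isErasable_of_forall_exists_edge
    (fun σ hσ => card_le_three_of_mem_complexOf (hmem σ hσ)) ?_ ?_
  · refine (Set.finite_range fun q : Arc G × Fin 13 =>
      copyFace port q.1 (dunceTriangle q.2)).subset fun σ hσ => htri σ hσ.1 hσ.2
  · intro S hS ⟨T, hT⟩
    obtain ⟨q, hq⟩ := htri T (hS hT).1 (hS hT).2
    -- As positions are below 13, this encodes the lexicographic order by rank, then position.
    let weight : Arc G × Fin 13 → ℕ := fun q => 13 * rank q.1 + q.2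
    obtain ⟨⟨e, i⟩, he, hmin⟩ := (measure weight).wf.has_min
      {q | copyFace port q.1 (dunceTriangle q.2) ∈ S} ⟨q, by simpa [hq] using hT⟩
    have hmin' : ∀ f j, copyFace port f (dunceTriangle j) ∈ S →
        13 * rank e + (i : ℕ) ≤ 13 * rank f + (j : ℕ) :=
      fun f j hf => not_lt.mp (hmin (f, j) hf)
    refine ⟨_, he, copyFace port e {exitLeft i, exitRight i}, ?_, ?_, ?_⟩
    · have hsub : ({exitLeft i, exitRight i} : Finset DunceVertex) ⊆ dunceTriangle i := by
        intro z hz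
        rcases Finset.mem_insert.mp hz with rfl | hz
        · exact exitLeft_mem i
        · exact Finset.mem_singleton.mp hz ▸ exitRight_mem i
      refine (copyFace_mono e hsub).ssubset_of_ne fun heq => ?_
      have h3 := card_of_mem_dunceFacets _ (dunceTriangle_mem i)
      rw [← copyFace_injective hG hport e heq, Finset.card_pair (exitLeft_ne_exitRight i)] at h3
      omega
    · rw [card_copyFace hG hport, Finset.card_pair (exitLeft_ne_exitRight i)]
    · intro T' hT' hsub
      obtain ⟨⟨f, j⟩, rfl⟩ := htri T' (hS hT').1 (hS hT').2
      have hl := hsub (copyMap_mem_copyFace e (Finset.mem_insert_self _ _))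
      have hr := hsub (copyMap_mem_copyFace e
        (Finset.mem_insert_of_mem (Finset.mem_singleton_self _)))
      have hle := hmin' f j hT'
      have hfe : f = e := by
        -- Only `ω_e` may be shared, and then with the copy of an arc `f` entering the tail of `e`.
        -- As `Γ_e` survives, `e` is not in `F`, so `f` has smaller rank, against minimality.
        by_cases hi : i = 0
        · subst hi
          obtain ⟨w, -, hw⟩ := mem_copyFace.mp hr
          refine (nameOf_eq_tip (nameOf_eq_of_copyMap_eq hport hw)).resolve_right fun hfe => ?_
          have heF : (e.tail, e.head) ∉ F := fun hmem' => (hS he).1.2 _ (hC e hmem') subset_rfl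
          have := hrank e f heF hfe
          omega
        · exact eq_of_exit_mem_copyFace hG hport hi hl hr
      subst hfe
      have hji := le_of_exit_mem i j (mem_of_copyMap_mem_copyFace hG hport hl)
        (mem_of_copyMap_mem_copyFace hG hport hr)
      have : j = i := by omega
      rw [this]

/-- The triangle `Γ_e` is internal in `K(G)` if there is an arc entering the tail of `e`. -/
theorem isInternalTwoFace_copyFace (hG : IsOrientedGraph G) (hport : IsAdmissible port)
    {e f : Arc G} (h : f.head = e.tail) {τ : Finset DunceVertex} (hτ : τ ∈ dunceFacets) :
    IsInternalTwoFace (complexOf port) (copyFace port e τ) := by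
  have h3 : (copyFace port e τ).card = 3 := by
    rw [card_copyFace hG hport, card_of_mem_dunceFacets τ hτ]
  have hmax : ∀ ρ ∈ complexOf port, ∀ T : Finset (KVertex port), T.card = 3 → T ⊆ ρ → ρ = T :=
    fun ρ hρ T hT hsub => (Finset.eq_of_subset_of_card_le hsub
      (hT ▸ card_le_three_of_mem_complexOf hρ)).symm
  refine ⟨copyFace_mem_complexOf e hτ, h3, fun ρ hρ hsub => hmax ρ hρ _ h3 hsub, ?_⟩
  rintro σ ⟨hσ, -, hlt, huniq⟩
  obtain ⟨g, -, τ', hτ', hne, hsub⟩ := exists_other_copyFace hG hport h hτ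
    ((complexOf port).isRelLowerSet_faces hσ).1 hlt
  refine hne (hmax _ (copyFace_mem_complexOf e hτ) _ ?_
    (huniq _ (copyFace_mem_complexOf g hτ') hsub)).symm
  rw [card_copyFace hG hport, card_of_mem_dunceFacets τ' hτ']

/-- If removing a set `C` of triangles makes `K(G)` erasable, then the arcs whose copies meet `C`
form a feedback arc set. -/
theorem isAcyclicDigraph_of_isErasable (hG : IsOrientedGraph G) (hport : IsAdmissible port)
    {F : Finset (V × V)} {C : Set (Finset (KVertex port))} (hC : ∀ c ∈ C, c.card = 3)
    (hF : ∀ e : Arc G, ∀ τ ∈ dunceFacets, copyFace port e τ ∈ C → (e.tail, e.head) ∈ F)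
    (her : IsErasable (removeFaces (complexOf port) C)) : IsAcyclicDigraph (deleteArcs G F) := by
  by_contra hcyc
  obtain ⟨A, ⟨v, hv⟩, hA⟩ := exists_set_of_not_isAcyclicDigraph hcyc
  have h3 : ∀ e : Arc G, ∀ τ ∈ dunceFacets, (copyFace port e τ).card = 3 := fun e τ hτ => by
    rw [card_copyFace hG hport, card_of_mem_dunceFacets τ hτ]
  -- The set consists of all triangles of the copies of arcs outside `F` with tail in `A`. Each such
  -- arc has a predecessor of the same kind, whose copy covers `ω`; all other proper faces are
  -- covered twice within their own copy.
  refine not_isErasable_of_no_free_face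
    (S := {T | ∃ e : Arc G, e.tail ∈ A ∧ (e.tail, e.head) ∉ F ∧
      ∃ τ ∈ dunceFacets, copyFace port e τ = T})
    (fun σ hσ => card_le_three_of_mem_complexOf (mem_removeFaces.mp hσ).1) ?_ ?_ ?_ ?_ her
  · obtain ⟨u, hu, huv⟩ := hA v hv
    exact ⟨_, ⟨(u, v), huv.1⟩, hu, huv.2, _, dunceTriangle_mem 0, rfl⟩
  · rintro _ ⟨e, -, -, τ, hτ, rfl⟩
    exact h3 e τ hτ
  · rintro _ ⟨e, he, heF, τ, hτ, rfl⟩ σ hne hσ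
    obtain ⟨u, hu, huv⟩ := hA _ he
    obtain ⟨g, hg, τ', hτ', hne', hsub⟩ := exists_other_copyFace hG hport
      (f := ⟨(u, e.tail), huv.1⟩) rfl hτ hne hσ
    rcases hg with rfl | rfl
    · exact ⟨_, ⟨g, he, heF, τ', hτ', rfl⟩, hne', hsub⟩
    · exact ⟨_, ⟨⟨(u, e.tail), huv.1⟩, hu, huv.2, τ', hτ', rfl⟩, hne', hsub⟩
  · rintro _ ⟨e, -, heF, τ, hτ, rfl⟩
    refine ⟨copyFace_mem_complexOf e hτ, fun c hc hsub => heF (hF e τ hτ ?_)⟩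
    rwa [← Finset.eq_of_subset_of_card_le hsub (by rw [h3 e τ hτ, hC c hc])]

/-- Delete `Γ_e` for the arcs of a minimum feedback arc set. Minimality gives each of them a
preceding arc, which makes `Γ_e` internal, and distinct arcs give distinct triangles. -/
theorem optMinFAS_mem_internalErasureSizes [Finite V] (hG : IsOrientedGraph G)
    (hport : IsAdmissible port) : optMinFAS G ∈ internalErasureSizes (complexOf port) := by
  classical
  obtain ⟨F, hF, hcard⟩ := exists_isFeedbackArcSet_card_eq_optMinFAS G
  let arc : {p // p ∈ F} → Arc G := fun p => ⟨p.1, hF.1 p.1 p.2⟩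
  refine ⟨F.attach.image fun p => copyFace port (arc p) (dunceTriangle 0), ?_, ?_, ?_⟩
  · rw [Finset.card_image_of_injective, Finset.card_attach, hcard]
    intro p q hpq
    have := eq_of_copyFace_eq hG hport (dunceTriangle_mem 0) hpq
    exact Subtype.ext (congrArg Subtype.val this).symm
  · intro T hT
    obtain ⟨p, -, rfl⟩ := Finset.mem_image.mp hT
    obtain ⟨u, hu⟩ := hF.exists_adj_tail hcard p.2
    exact isInternalTwoFace_copyFace hG hport (f := ⟨(u, p.1.1), hu⟩) rfl (dunceTriangle_mem 0)
  · refine isErasable_removeFaces hG hport hF fun e he => ?_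
    exact Finset.mem_coe.mpr (Finset.mem_image.mpr ⟨⟨(e.tail, e.head), he⟩, Finset.mem_attach _ _, rfl⟩)

/-- Each deleted triangle is charged to the unique arc whose copy contains it. Several triangles may
share an arc, so the resulting feedback arc set is at most as large. -/
theorem optMinFAS_le_of_mem_erasureSizes (hG : IsOrientedGraph G) (hport : IsAdmissible port)
    {k : ℕ} (hk : k ∈ erasureSizes (complexOf port)) : optMinFAS G ≤ k := by
  classical
  obtain ⟨C, rfl, hC, her⟩ := hk
  choose arc facet hfacet heq using fun T : {T // T ∈ C} =>
    exists_eq_copyFace (hC T.1 T.2).1 (hC T.1 T.2).2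
  refine (optMinFAS_le_card (F := C.attach.image fun T => ((arc T).tail, (arc T).head))
    ⟨?_, ?_⟩).trans (Finset.card_image_le.trans Finset.card_attach.le)
  · intro p hp
    obtain ⟨T, -, rfl⟩ := Finset.mem_image.mp hp
    exact (arc T).adj
  · refine isAcyclicDigraph_of_isErasable hG hport (fun c hc => (hC c hc).2)
      (fun e τ hτ hmem => ?_) her
    refine Finset.mem_image.mpr ⟨⟨_, hmem⟩, Finset.mem_attach _ _, ?_⟩
    rw [eq_of_copyFace_eq hG hport hτ (heq ⟨_, hmem⟩)]

end Construction

theorem mainTheorem8 {V : Type*} [Finite V] (G : Digraph V)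
    (horiented : IsOrientedGraph G) (hdegree : IsDegreeThree G)
    (port : Arc G → Arc G → Bool) (hport : IsAdmissible port) :
    er (complexOf port) = optMinFAS G ∧
    IsLeast (internalErasureSizes (complexOf port)) (optMinFAS G) ∧
    IsLeast (erasureSizes (complexOf port)) (optMinFAS G) := by
  have hmem := optMinFAS_mem_internalErasureSizes horiented hport
  have hsub : internalErasureSizes (complexOf port) ⊆ erasureSizes (complexOf port) := by
    rintro k ⟨C, hk, hC, her⟩
    exact ⟨C, hk, fun τ hτ => ⟨(hC τ hτ).1, (hC τ hτ).2.1⟩, her⟩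
  have hle : ∀ k ∈ erasureSizes (complexOf port), optMinFAS G ≤ k :=
    fun k hk => optMinFAS_le_of_mem_erasureSizes horiented hport hk
  have hleast : IsLeast (internalErasureSizes (complexOf port)) (optMinFAS G) :=
    ⟨hmem, fun k hk => hle k (hsub hk)⟩
  exact ⟨hleast.csInf_eq, hleast, hsub hmem, hle⟩
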